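/- For integers $p,k\ge 0$ let $G_0(k)=1$ and, for $p\ge 1$, \[ G_p(k)=\sum_{n_1=0}^{k-1}\frac{1}{(2n_1+1)^2}\sum_{n_2=0}^{n_1-1}\frac{1}{(2n_2+1)^2}\cdots\sum_{n_p=0}^{n_{p-1}-1}\frac{1}{(2n_p+1)^2}, \] and for $k\ge 1$ let $H_1(k)=1$ and, for $p\ge 1$, \[ H_{p+1}(k)=\sum_{n_1=1}^{k-1}\frac{1}{(2n_1)^2}\sum_{n_2=1}^{n_1-1}\frac{1}{(2n_2)^2}\cdots\sum_{n_p=1}^{n_{p-1}-1}\frac{1}{(2n_p)^2}, \] where empty sums are $0$. Then for all integers $\ell\ge 0$ and $p\ge 0$ the following series converge and \begin{align*} \sum_{k=0}^\infty\frac{\binom{2k}{k}G_p(k)}{4^k(2k+2\ell+2)} &=\frac{(-1)^{p-1}}{4^\ell}\sum_{j=0}^{p-1}\left(\sum_{k=0}^\ell\frac{\binom{2\ell+1}{\ell-k}}{(2k+1)^{2p-2j}}\right)\frac{(-1)^j\left(\frac{\pi}{2}\right)^{2j+1}}{(2j+1)!} +\frac{(-1)^p}{4^\ell}\sum_{k=0}^\ell\frac{\binom{2\ell+1}{\ell-k}(-1)^k}{(2k+1)^{2p+1}},\\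 \sum_{k=0}^\infty\frac{\binom{2k}{k}G_p(k)}{4^k(2k+2\ell+1)} &=\frac{(-1)^{p-1}}{4^{\ell+p}}\sum_{j=0}^{p-1}\left(\sum_{k=1}^\ell\frac{\binom{2\ell}{\ell-k}}{k^{2p-2j}}\right)\frac{(-1)^j\pi^{2j+1}}{(2j+1)!} +\frac{\binom{2\ell}{\ell}}{2^{2\ell+2p+1}}\cdot\frac{\pi^{2p+1}}{(2p+1)!}, \end{align*} and for all integers $\ell\ge 0$ and $p\ge 1$ the following series converge and \begin{align*} \sum_{k=1}^{\infty}\frac{4^kH_p(k)}{\binom{2k}{k}\,2k\,(2k+2\ell+1)} &=\frac{(-1)^{p-1}}{4^\ell}\sum_{j=0}^{p-1}\left(\sum_{k=0}^\ell\frac{\binom{2\ell+1}{\ell-k}}{(2k+1)^{2p-2j}}\right)\frac{(-1)^j\left(\frac{\pi}{2}\right)^{2j}}{(2j)!},\\ \sum_{k=1}^{\infty}\frac{4^kH_p(k)}{\binom{2k}{k}\,2k\,(2k+2\ell)} &=\frac{(-1)^{p-1}}{2^{2\ell+2p-1}}\sum_{j=0}^{p-1}\left(\sum_{k=1}^\ell\frac{\binom{2\ell}{\ell-k}}{k^{2p-2j}}\right)\frac{(-1)^j\pi^{2j}}{(2j)!}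 +\frac{\binom{2\ell}{\ell}}{4^{\ell+p}}\cdot\frac{\pi^{2p}}{(2p)!} +\frac{(-1)^p}{2^{2\ell+2p-1}}\sum_{k=1}^\ell\frac{\binom{2\ell}{\ell-k}(-1)^k}{k^{2p}}. \end{align*} -/

import Mathlib

open scoped Nat

/-- The multiple `t`-harmonic sum `G_p(k)`: `G_0(k) = 1`, and for `p ≥ 1`, `G_p(k)` is the nested sum
`∑_{n₁=0}^{k-1} 1/(2n₁+1)² ∑_{n₂=0}^{n₁-1} 1/(2n₂+1)² ⋯ ∑_{n_p=0}^{n_{p-1}-1} 1/(2n_p+1)²`. -/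
noncomputable def arcsinG : ℕ → ℕ → ℝ
  | 0, _ => 1
  | p + 1, k => ∑ n ∈ Finset.range k, 1 / (2 * (n : ℝ) + 1) ^ 2 * arcsinG p n

/-- The `p`-fold nested sum
`∑_{n₁=1}^{k-1} 1/(2n₁)² ∑_{n₂=1}^{n₁-1} 1/(2n₂)² ⋯ ∑_{n_p=1}^{n_{p-1}-1} 1/(2n_p)²`
(equal to `1` for `p = 0`), that is, `H_{p+1}(k)`. -/
noncomputable def arcsinHSucc : ℕ → ℕ → ℝ
  | 0, _ => 1
  | p + 1, k => ∑ n ∈ Finset.Ico 1 k, 1 / (2 * (n : ℝ)) ^ 2 * arcsinHSucc p n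

/-- The multiple harmonic sum `H_p(k)`, which is meant only for `p ≥ 1`: `H_1(k) = 1`, and
`H_{p+1}(k)` is the `p`-fold nested sum `arcsinHSucc p k`. -/
noncomputable def arcsinH (p k : ℕ) : ℝ := arcsinHSucc (p - 1) k

section

open MeasureTheory intervalIntegral Set Filter Topology

/-! Write c_m for `wallisRatio m`. For e = 0, 1 and 0 ≤ t < π/2, t^(2p+e)/(2p+e)! equals cos t · ∑_k
`nestedSum e p k` · c_(2k+e) · sin^(2k+e) t (`hasSum_nestedSum_sin_pow`). This goes by induction on
p: integrating twice from 0 turns c_m sin^m t cos t into c_m/(m+1) · ∫ sin^(m+1), which is 1/(m+1)²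
times a tail of the p = 0 series (`hasSum_sinTail`). Exchanging the two sums adds one level of
nesting.

Multiplying by sin^n t and integrating over [0, π/2] identifies each series with ∫ t^(2p+e)/(2p+e)!
· sin^n t (`hasSum_nestedSum_integral`). The four formulas are e = 0, 1 with n = 2ℓ+1, 2ℓ. The
integrals are evaluated by expanding sin^n t in multiple angles (`sin_pow_odd`, `sin_pow_even`) and
integrating by parts twice, which gives a recurrence in p solved by `sum_mul_recurrence`. -/

/-- The Wallis ratios `(m-1)!!/m!!`, normalised to be `1` at `m = 0` and `m = 1`. -/
noncomputable def wallisRatio : ℕ → ℝ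
  | 0 => 1
  | 1 => 1
  | m + 2 => ((m : ℝ) + 1) / (m + 2) * wallisRatio m

/-- The nested sums of `1 / (2n+1+e)²`; `e = 0` gives `arcsinG` and `e = 1` gives `arcsinHSucc`. -/
noncomputable def nestedSum (e : ℕ) : ℕ → ℕ → ℝ
  | 0, _ => 1
  | p + 1, k => ∑ n ∈ Finset.range k, 1 / (2 * (n : ℝ) + 1 + e) ^ 2 * nestedSum e p n

/-! ### Wallis ratios and nested sums -/

theorem wallisRatio_nonneg : ∀ m, 0 ≤ wallisRatio m
  | 0 => by simp [wallisRatio]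
  | 1 => by simp [wallisRatio]
  | m + 2 => by
    have := wallisRatio_nonneg m
    rw [wallisRatio]; positivity

theorem wallisRatio_le_one : ∀ m, wallisRatio m ≤ 1
  | 0 => by simp [wallisRatio]
  | 1 => by simp [wallisRatio]
  | m + 2 => by
    rw [wallisRatio]
    refine mul_le_one₀ ?_ (wallisRatio_nonneg m) (wallisRatio_le_one m)
    rw [div_le_one (by positivity)]; linarith

theorem wallisRatio_two_mul (k : ℕ) :
    wallisRatio (2 * k) = ((2 * k).choose k : ℝ) / 4 ^ k := by
  induction k with
  | zero => simp [wallisRatio]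
  | succ k ih =>
    have h : ((k : ℝ) + 1) * ((2 * (k + 1)).choose (k + 1) : ℝ)
        = 2 * (2 * k + 1) * ((2 * k).choose k : ℝ) := by
      exact_mod_cast Nat.succ_mul_centralBinom_succ k
    rw [show 2 * (k + 1) = 2 * k + 2 by ring, wallisRatio, ih,
      show 2 * k + 2 = 2 * (k + 1) by ring, pow_succ]
    push_cast
    field_simp
    linear_combination -2 * h

theorem wallisRatio_two_mul_add_one (k : ℕ) :
    wallisRatio (2 * k + 1) =
      (4 : ℝ) ^ (k + 1) / (((2 * (k + 1)).choose (k + 1) : ℝ) * (2 * ((k : ℝ) + 1))) := by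
  induction k with
  | zero => simp [wallisRatio]; norm_num
  | succ k ih =>
    have h : (((k + 1 : ℕ) : ℝ) + 1) * ((2 * (k + 1 + 1)).choose (k + 1 + 1) : ℝ)
        = 2 * (2 * (k + 1 : ℕ) + 1) * ((2 * (k + 1)).choose (k + 1) : ℝ) := by
      exact_mod_cast Nat.succ_mul_centralBinom_succ (k + 1)
    have h1 : (0 : ℝ) < ((2 * (k + 1)).choose (k + 1) : ℝ) := by
      exact_mod_cast Nat.centralBinom_pos (k + 1)
    have h2 : (0 : ℝ) < ((2 * (k + 1 + 1)).choose (k + 1 + 1) : ℝ) := by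
      exact_mod_cast Nat.centralBinom_pos (k + 1 + 1)
    rw [show 2 * (k + 1) + 1 = 2 * k + 1 + 2 by ring, wallisRatio, ih, pow_succ _ (k + 1)]
    push_cast at h ⊢
    rw [div_mul_div_comm, div_eq_div_iff (by positivity) (by positivity)]
    linear_combination (4 ^ (k + 1) * 4 * ((k : ℝ) + 1)) * h

theorem nestedSum_nonneg (e p k : ℕ) : 0 ≤ nestedSum e p k := by
  induction p generalizing k with
  | zero => simp [nestedSum]
  | succ p ih => exact Finset.sum_nonneg fun n _ => mul_nonneg (by positivity) (ih n)

theorem arcsinG_eq_nestedSum (p k : ℕ) : arcsinG p k = nestedSum 0 p k := by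
  induction p generalizing k with
  | zero => simp [nestedSum, arcsinG]
  | succ p ih => simp [nestedSum, arcsinG, ih]

theorem arcsinHSucc_succ_eq_nestedSum (p k : ℕ) : arcsinHSucc p (k + 1) = nestedSum 1 p k := by
  induction p generalizing k with
  | zero => simp [nestedSum, arcsinHSucc]
  | succ p ih =>
    rw [nestedSum, arcsinHSucc, Finset.sum_Ico_eq_sum_range]
    refine Finset.sum_congr (by simp) fun n _ => ?_
    rw [add_comm 1 n, ih]
    push_cast
    ring

/-! ### Exchange of sums and integrals -/

/-- Termwise integration of a series of nonnegative continuous functions with a continuous sum. -/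
theorem hasSum_integral_of_nonneg {F : ℕ → ℝ → ℝ} {f : ℝ → ℝ} {b : ℝ} (hb : 0 ≤ b)
    (hF : ∀ k, Continuous (F k)) (hf : Continuous f)
    (h0 : ∀ k, ∀ t ∈ Ico 0 b, 0 ≤ F k t)
    (h : ∀ t ∈ Ico 0 b, HasSum (fun k => F k t) (f t)) :
    HasSum (fun k => ∫ t in (0 : ℝ)..b, F k t) (∫ t in (0 : ℝ)..b, f t) := by
  -- The endpoint is null and must be dropped: at π/2 the factor cos t kills every term of the
  -- series used later, but not its intended sum.
  have key : ∀ᵐ t : ℝ, t ∈ uIoc 0 b → t ∈ Ico 0 b := by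
    filter_upwards [Measure.ae_ne volume b] with t ht hm
    rw [uIoc_of_le hb] at hm
    exact ⟨hm.1.le, lt_of_le_of_ne hm.2 ht⟩
  -- By nonnegativity the terms dominate themselves, and their sum `f` is integrable.
  refine hasSum_integral_of_dominated_convergence (fun k t => F k t)
    (fun k => (hF k).aestronglyMeasurable) ?_ ?_ ?_ ?_
  · intro k
    filter_upwards [key] with t ht hm
    rw [Real.norm_of_nonneg (h0 k t (ht hm))]
  · filter_upwards [key] with t ht hm
    exact (h t (ht hm)).summable
  · refine (hf.intervalIntegrable 0 b).congr_ae ?_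
    rw [EventuallyEq, ae_restrict_iff' measurableSet_uIoc]
    filter_upwards [key] with t ht hm
    exact (h t (ht hm)).tsum_eq.symm
  · filter_upwards [key] with t ht hm
    exact h t (ht hm)

/-- Interchange of summation in `∑ k, d k * ∑ n < k, w n` for nonnegative `d`, `w`. -/
theorem hasSum_mul_sum_range {d w r : ℕ → ℝ} {S : ℝ} (hd : ∀ k, 0 ≤ d k) (hw : ∀ n, 0 ≤ w n)
    (hr : ∀ n, HasSum (fun k => if n < k then d k else 0) (r n))
    (hS : HasSum (fun n => w n * r n) S) :
    HasSum (fun k => d k * ∑ n ∈ Finset.range k, w n) S := by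
  let f : ℕ × ℕ → ℝ := fun x => w x.1 * (if x.1 < x.2 then d x.2 else 0)
  have hrow : ∀ n, HasSum (fun k => f (n, k)) (w n * r n) := fun n => (hr n).mul_left _
  have hf0 : 0 ≤ f := fun x => mul_nonneg (hw _) (by split_ifs <;> simp [hd])
  have hsum : Summable f := by
    rw [summable_prod_of_nonneg hf0]
    exact ⟨fun n => (hrow n).summable, hS.summable.congr fun n => (hrow n).tsum_eq.symm⟩
  have hfS : HasSum f S := by
    have h := hsum.hasSum
    rwa [← hS.unique (h.prod_fiberwise hrow)] at h
  have hswap : HasSum (f ∘ Equiv.prodComm ℕ ℕ) S := (Equiv.prodComm ℕ ℕ).hasSum_iff.mpr hfS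
  suffices hcol : ∀ k, HasSum (fun n => f (n, k)) (d k * ∑ n ∈ Finset.range k, w n) from
    hswap.prod_fiberwise hcol
  intro k
  have := hasSum_sum_of_ne_finset_zero (L := .unconditional ℕ) (f := fun n => f (n, k))
    (s := Finset.range k)
    (fun n hn => by simp only [Finset.mem_range] at hn; simp [f, hn])
  convert this using 1
  rw [Finset.mul_sum]
  refine Finset.sum_congr rfl fun n hn => ?_
  simp only [Finset.mem_range] at hn
  simp [f, hn, mul_comm]

/-! ### Powers of t as series in sin t -/

/-- `(m+1) c_m ∫₀ᵗ sin^(m+1)`, the tail of the Wallis-ratio series in powers of `sin t`. -/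
noncomputable def sinTail (t : ℝ) (m : ℕ) : ℝ :=
  (m + 1) * wallisRatio m * ∫ x in (0 : ℝ)..t, Real.sin x ^ (m + 1)

/-- The reduction formula for ∫ sin^(m+3); the normalisation works because (m+2) c_(m+2) = (m+1)
c_m. -/
theorem sinTail_add_two (t : ℝ) (m : ℕ) :
    sinTail t (m + 2) =
      sinTail t m - wallisRatio (m + 2) * Real.sin t ^ (m + 2) * Real.cos t := by
  rw [sinTail, sinTail, show m + 2 + 1 = m + 1 + 2 by ring, integral_sin_pow, wallisRatio]
  simp only [Real.sin_zero]
  push_cast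
  rw [zero_pow (by omega)]
  field_simp
  ring

theorem sinTail_nonneg {t : ℝ} (ht : t ∈ Ico 0 (Real.pi / 2)) (m : ℕ) : 0 ≤ sinTail t m := by
  refine mul_nonneg (mul_nonneg (by positivity) (wallisRatio_nonneg m)) ?_
  refine integral_nonneg ht.1 fun x hx => pow_nonneg ?_ _
  exact Real.sin_nonneg_of_nonneg_of_le_pi hx.1 (by linarith [hx.2, ht.2, ht.1])

/-- Monotonicity of sin bounds the tail by t (m+1) sin^(m+1) t, and sin t < 1 since t < π/2. -/
theorem tendsto_sinTail {t : ℝ} (ht : t ∈ Ico 0 (Real.pi / 2)) :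
    Tendsto (sinTail t) atTop (𝓝 0) := by
  have hpi := Real.pi_pos
  have hs0 : 0 ≤ Real.sin t :=
    Real.sin_nonneg_of_nonneg_of_le_pi ht.1 (by linarith [ht.2])
  have hs1 : Real.sin t < 1 := by
    rw [← Real.sin_pi_div_two]
    exact Real.sin_lt_sin_of_lt_of_le_pi_div_two (by linarith [ht.1]) le_rfl ht.2
  have hlim : Tendsto (fun m : ℕ => t * (((m + 1 : ℕ) : ℝ) * Real.sin t ^ (m + 1))) atTop (𝓝 0) := by
    have := ((tendsto_self_mul_const_pow_of_lt_one hs0 hs1).comp (tendsto_add_atTop_nat 1)).const_mul t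
    simpa using this
  refine squeeze_zero (sinTail_nonneg ht) (fun m => ?_) hlim
  have hint : ∫ x in (0 : ℝ)..t, Real.sin x ^ (m + 1) ≤ ∫ _ in (0 : ℝ)..t, Real.sin t ^ (m + 1) := by
    refine integral_mono_on ht.1 (Continuous.intervalIntegrable (by fun_prop) _ _) (by simp) fun x hx => ?_
    refine pow_le_pow_left₀ (Real.sin_nonneg_of_nonneg_of_le_pi hx.1 (by linarith [hx.2, ht.2])) ?_ _
    exact Real.sin_le_sin_of_le_of_le_pi_div_two (by linarith [hx.1]) ht.2.le hx.2
  rw [intervalIntegral.integral_const, sub_zero, smul_eq_mul] at hint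
  have h1 := wallisRatio_le_one m
  have h0 := wallisRatio_nonneg m
  have hp := pow_nonneg hs0 (m + 1)
  calc sinTail t m ≤ (m + 1) * 1 * (t * Real.sin t ^ (m + 1)) := by
        unfold sinTail
        have : 0 ≤ t * Real.sin t ^ (m + 1) := mul_nonneg ht.1 hp
        refine mul_le_mul ?_ hint ?_ (by positivity)
        · gcongr
        · exact integral_nonneg ht.1 fun x hx => pow_nonneg
            (Real.sin_nonneg_of_nonneg_of_le_pi hx.1 (by linarith [hx.2, ht.2])) _
    _ = _ := by push_cast; ring

/-- The partial sums telescope by `sinTail_add_two`, and the remainder tends to 0. -/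
theorem hasSum_sinTail {t : ℝ} (ht : t ∈ Ico 0 (Real.pi / 2)) (e n : ℕ) :
    HasSum (fun k => if n < k then
      wallisRatio (2 * k + e) * Real.sin t ^ (2 * k + e) * Real.cos t else 0)
      (sinTail t (2 * n + e)) := by
  have hs0 : 0 ≤ Real.sin t :=
    Real.sin_nonneg_of_nonneg_of_le_pi ht.1 (by linarith [ht.2, ht.1])
  have hc0 : 0 ≤ Real.cos t :=
    Real.cos_nonneg_of_neg_pi_div_two_le_of_le (by linarith [ht.2, ht.1]) ht.2.le
  rw [hasSum_iff_tendsto_nat_of_nonneg]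
  · have key : ∀ K, ∑ k ∈ Finset.range (n + 1 + K), (if n < k then
        wallisRatio (2 * k + e) * Real.sin t ^ (2 * k + e) * Real.cos t else 0)
        = sinTail t (2 * n + e) - sinTail t (2 * (n + K) + e) := by
      intro K
      induction K with
      | zero =>
        simp only [add_zero, sub_self]
        refine Finset.sum_eq_zero fun k hk => ?_
        rw [Finset.mem_range] at hk
        rw [if_neg (by omega)]
      | succ K ih =>
        rw [← add_assoc, Finset.sum_range_succ, ih, if_pos (by omega),
          show 2 * (n + (K + 1)) + e = 2 * (n + K) + e + 2 by ring, sinTail_add_two,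
          show 2 * (n + 1 + K) + e = 2 * (n + K) + e + 2 by ring]
        ring
    rw [← tendsto_add_atTop_iff_nat (n + 1)]
    have h2 : Tendsto (fun K => 2 * (n + K) + e) atTop atTop :=
      tendsto_atTop_mono (fun K => by simp only [id]; omega) tendsto_id
    have := ((tendsto_sinTail ht).comp h2).const_sub (sinTail t (2 * n + e))
    rw [sub_zero] at this
    refine this.congr fun K => ?_
    rw [add_comm K, key, Function.comp]
  · intro k
    split_ifs
    · exact mul_nonneg (mul_nonneg (wallisRatio_nonneg _) (pow_nonneg hs0 _)) hc0
    · exact le_rfl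

/-- The k = 0 term plus the tail after it: cos t + ∫ sin = 1 for e = 0, and sin t cos t + 2 ∫ sin² =
t for e = 1. -/
theorem hasSum_wallisRatio_mul_sin_pow {t : ℝ} (ht : t ∈ Ico 0 (Real.pi / 2)) {e : ℕ}
    (he : e < 2) :
    HasSum (fun k => wallisRatio (2 * k + e) * Real.sin t ^ (2 * k + e) * Real.cos t) (t ^ e) := by
  have h := (hasSum_ite_eq 0 (wallisRatio e * Real.sin t ^ e * Real.cos t)).add
    (hasSum_sinTail ht e 0)
  convert h using 1
  · funext k
    rcases Nat.eq_zero_or_pos k with rfl | hk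
    · simp
    · simp [hk, hk.ne']
  · interval_cases e
    · simp [sinTail, wallisRatio]
    · simp [sinTail, wallisRatio, integral_sin_sq]
      ring

theorem integral_sin_pow_mul_cos_self (n : ℕ) (t : ℝ) :
    ∫ x in (0 : ℝ)..t, Real.sin x ^ n * Real.cos x = Real.sin t ^ (n + 1) / (n + 1) := by
  have := integral_sin_pow_mul_cos_pow_odd (a := 0) (b := t) n 0
  simpa using this

theorem integral_pow_div_factorial (m : ℕ) (t : ℝ) :
    ∫ x in (0 : ℝ)..t, x ^ m / (m ! : ℝ) = t ^ (m + 1) / ((m + 1)! : ℝ) := by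
  rw [intervalIntegral.integral_div, integral_pow, Nat.factorial_succ]
  push_cast
  have := Nat.factorial_ne_zero m
  field_simp
  simp

theorem sin_nonneg_of_mem {t b : ℝ} (hb : b ≤ Real.pi / 2) (ht : t ∈ Ico 0 b) : 0 ≤ Real.sin t :=
  Real.sin_nonneg_of_nonneg_of_le_pi ht.1 (by linarith [ht.2, ht.1])

theorem cos_nonneg_of_mem {t b : ℝ} (hb : b ≤ Real.pi / 2) (ht : t ∈ Ico 0 b) : 0 ≤ Real.cos t :=
  Real.cos_nonneg_of_neg_pi_div_two_le_of_le (by linarith [ht.2, ht.1]) (by linarith [ht.2])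

/-- The expansion of `t ^ (2p+e) / (2p+e)!` in powers of `sin t`. -/
theorem hasSum_nestedSum_sin_pow {e : ℕ} (he : e < 2) (p : ℕ) :
    ∀ t ∈ Ico 0 (Real.pi / 2),
    HasSum (fun k => nestedSum e p k *
      (wallisRatio (2 * k + e) * (Real.sin t ^ (2 * k + e) * Real.cos t)))
      (t ^ (2 * p + e) / ((2 * p + e)! : ℝ)) := by
  induction p with
  | zero =>
    intro t ht
    have := hasSum_wallisRatio_mul_sin_pow ht he
    simp only [nestedSum, one_mul]
    convert this using 1
    · simp only [mul_assoc]
    · interval_cases e <;> simp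
  | succ p ih =>
    have h1 : ∀ s ∈ Ico 0 (Real.pi / 2),
        HasSum (fun k => nestedSum e p k * (wallisRatio (2 * k + e) *
          (Real.sin s ^ (2 * k + e + 1) / (2 * k + e + 1))))
          (s ^ (2 * p + e + 1) / ((2 * p + e + 1)! : ℝ)) := by
      intro s hs
      have := hasSum_integral_of_nonneg hs.1 (fun k => by fun_prop) (by fun_prop)
        (fun k t ht => mul_nonneg (nestedSum_nonneg e p k) (mul_nonneg (wallisRatio_nonneg _)
          (mul_nonneg (pow_nonneg (sin_nonneg_of_mem hs.2.le ht) _)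
            (cos_nonneg_of_mem hs.2.le ht))))
        (fun t ht => ih t ⟨ht.1, ht.2.trans hs.2⟩)
      simp only [intervalIntegral.integral_const_mul, integral_pow_div_factorial,
        integral_sin_pow_mul_cos_self] at this
      exact_mod_cast this
    intro t ht
    have h2 := hasSum_integral_of_nonneg ht.1 (fun k => by fun_prop) (by fun_prop)
        (fun k s hs => mul_nonneg (nestedSum_nonneg e p k) (mul_nonneg (wallisRatio_nonneg _)
          (div_nonneg (pow_nonneg (sin_nonneg_of_mem ht.2.le hs) _) (by positivity))))
        (fun s hs => h1 s ⟨hs.1, hs.2.trans ht.2⟩)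
    rw [integral_pow_div_factorial] at h2
    simp only [intervalIntegral.integral_const_mul, intervalIntegral.integral_div] at h2
    -- The integral of sin^(2n+e+1) left by the second integration is a multiple of `sinTail t
    -- (2n+e)`, so the new series is a double sum over n < k; the factors 1/(2n+e+1)² are the new
    -- weights.
    have h3 := hasSum_mul_sum_range
      (d := fun k => wallisRatio (2 * k + e) * Real.sin t ^ (2 * k + e) * Real.cos t)
      (w := fun n => 1 / (2 * (n : ℝ) + 1 + e) ^ 2 * nestedSum e p n)
      (fun k => mul_nonneg (mul_nonneg (wallisRatio_nonneg _)
        (pow_nonneg (sin_nonneg_of_mem le_rfl ht) _)) (cos_nonneg_of_mem le_rfl ht))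
      (fun n => mul_nonneg (by positivity) (nestedSum_nonneg e p n))
      (hasSum_sinTail ht e) (S := t ^ (2 * p + e + 1 + 1) / ((2 * p + e + 1 + 1)! : ℝ))
      (by
        convert h2 using 1
        funext n
        rw [sinTail]
        push_cast
        field_simp
        ring)
    rw [show 2 * (p + 1) + e = 2 * p + e + 1 + 1 by ring]
    convert h3 using 1
    funext k
    rw [nestedSum]
    ring

theorem hasSum_nestedSum_integral {e : ℕ} (he : e < 2) (p n : ℕ) :
    HasSum (fun k : ℕ => nestedSum e p k * wallisRatio (2 * k + e) / (2 * k + e + n + 1))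
      (∫ t in (0 : ℝ)..(Real.pi / 2), t ^ (2 * p + e) / ((2 * p + e)! : ℝ) * Real.sin t ^ n) := by
  have h := hasSum_integral_of_nonneg (b := Real.pi / 2) (by positivity)
    (F := fun k t => nestedSum e p k * wallisRatio (2 * k + e) *
      (Real.sin t ^ (2 * k + e + n) * Real.cos t))
    (f := fun t => t ^ (2 * p + e) / ((2 * p + e)! : ℝ) * Real.sin t ^ n)
    (fun k => by fun_prop) (by fun_prop)
    (fun k t ht => mul_nonneg (mul_nonneg (nestedSum_nonneg e p k) (wallisRatio_nonneg _))
      (mul_nonneg (pow_nonneg (sin_nonneg_of_mem le_rfl ht) _) (cos_nonneg_of_mem le_rfl ht)))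
    (fun t ht => by
      have h := (hasSum_nestedSum_sin_pow he p t ht).mul_right (Real.sin t ^ n)
      convert! h using 2 with k
      rw [pow_add _ (2 * k + e)]
      ring)
  simp only [intervalIntegral.integral_const_mul, integral_sin_pow_mul_cos_self,
    Real.sin_pi_div_two, one_pow] at h
  convert h using 1
  funext k
  push_cast
  ring

/-! ### Powers of sine in multiple angles -/

theorem two_mul_cos_pow (n : ℕ) (u : ℝ) :
    (2 * Real.cos u) ^ n =
      ∑ j ∈ Finset.range (n + 1), (n.choose j : ℝ) * Real.cos ((2 * (j : ℝ) - n) * u) := by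
  have h : ((2 * Real.cos u : ℝ) : ℂ) ^ n = ∑ j ∈ Finset.range (n + 1),
      (n.choose j : ℂ) * Complex.exp (((2 * (j : ℝ) - n) * u : ℝ) * Complex.I) := by
    push_cast
    rw [Complex.two_cos, add_pow]
    refine Finset.sum_congr rfl fun j hj => ?_
    have hj : j ≤ n := by simpa [Nat.lt_succ_iff] using hj
    rw [← Complex.exp_nat_mul, ← Complex.exp_nat_mul, ← Complex.exp_add, mul_comm]
    push_cast [Nat.cast_sub hj]
    congr 2
    ring
  have h' := congrArg Complex.re h
  rw [← Complex.ofReal_pow, Complex.ofReal_re, Complex.re_sum] at h'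
  rw [h']
  refine Finset.sum_congr rfl fun j _ => ?_
  rw [← Complex.ofReal_natCast, Complex.re_ofReal_mul, Complex.exp_ofReal_mul_I_re]

theorem cos_odd_mul_sub (k : ℕ) (t : ℝ) :
    Real.cos ((2 * (k : ℝ) + 1) * (t - Real.pi / 2)) =
      (-1) ^ k * Real.sin ((2 * (k : ℝ) + 1) * t) := by
  rw [show (2 * (k : ℝ) + 1) * (t - Real.pi / 2)
    = ((2 * (k : ℝ) + 1) * t - Real.pi / 2) - k * Real.pi by ring,
    Real.cos_sub_nat_mul_pi, Real.cos_sub_pi_div_two]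

theorem cos_even_mul_sub (k : ℕ) (t : ℝ) :
    Real.cos (2 * (k : ℝ) * (t - Real.pi / 2)) = (-1) ^ k * Real.cos (2 * (k : ℝ) * t) := by
  rw [show 2 * (k : ℝ) * (t - Real.pi / 2) = 2 * (k : ℝ) * t - k * Real.pi by ring,
    Real.cos_sub_nat_mul_pi]

/-- Put u = t - π/2 in `two_mul_cos_pow` and pair the opposite frequencies 2k+1 and -(2k+1), whose
binomial coefficients agree. The shift by π/2 produces the sign (-1)^k. -/
theorem sin_pow_odd (l : ℕ) (t : ℝ) :
    Real.sin t ^ (2 * l + 1) = 1 / 4 ^ l * ∑ k ∈ Finset.range (l + 1),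
      ((2 * l + 1).choose (l - k) : ℝ) * ((-1) ^ k * Real.sin ((2 * (k : ℝ) + 1) * t)) := by
  have h := two_mul_cos_pow (2 * l + 1) (t - Real.pi / 2)
  rw [Real.cos_sub_pi_div_two, show 2 * l + 1 + 1 = (l + 1) + (l + 1) by ring,
    Finset.sum_range_add, ← Finset.sum_range_reflect, ← Finset.sum_add_distrib] at h
  have h2 : ∀ k ∈ Finset.range (l + 1),
      ((2 * l + 1).choose (l + 1 - 1 - k) : ℝ) *
          Real.cos ((2 * ((l + 1 - 1 - k : ℕ) : ℝ) - (2 * l + 1 : ℕ)) * (t - Real.pi / 2)) +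
        ((2 * l + 1).choose (l + 1 + k) : ℝ) *
          Real.cos ((2 * ((l + 1 + k : ℕ) : ℝ) - (2 * l + 1 : ℕ)) * (t - Real.pi / 2))
      = 2 * (((2 * l + 1).choose (l - k) : ℝ) *
          ((-1) ^ k * Real.sin ((2 * (k : ℝ) + 1) * t))) := by
    intro k hk
    have hk : k ≤ l := by simpa [Nat.lt_succ_iff] using hk
    rw [Nat.add_sub_cancel, ← cos_odd_mul_sub,
      Nat.choose_symm_of_eq_add (show 2 * l + 1 = (l + 1 + k) + (l - k) by omega),
      ← Real.cos_neg ((2 * ((l - k : ℕ) : ℝ) - _) * _)]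
    push_cast [Nat.cast_sub hk]
    ring_nf
  rw [Finset.sum_congr rfl h2, ← Finset.mul_sum, mul_pow] at h
  rw [pow_succ, pow_mul] at h
  norm_num at h
  rw [one_div, eq_inv_mul_iff_mul_eq₀ (by positivity)]
  linear_combination h / 2

theorem sin_pow_even (l : ℕ) (t : ℝ) :
    Real.sin t ^ (2 * l) = 1 / 4 ^ l * (((2 * l).choose l : ℝ) + 2 * ∑ k ∈ Finset.Icc 1 l,
      ((2 * l).choose (l - k) : ℝ) * ((-1) ^ k * Real.cos (2 * (k : ℝ) * t))) := by
  have h := two_mul_cos_pow (2 * l) (t - Real.pi / 2)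
  rw [Real.cos_sub_pi_div_two, show 2 * l + 1 = l + (l + 1) by ring,
    Finset.sum_range_add, ← Finset.sum_range_reflect, Finset.sum_range_succ' _ l, ← add_assoc,
    ← Finset.sum_add_distrib] at h
  have h2 : ∀ k ∈ Finset.range l,
      ((2 * l).choose (l - 1 - k) : ℝ) *
          Real.cos ((2 * ((l - 1 - k : ℕ) : ℝ) - (2 * l : ℕ)) * (t - Real.pi / 2)) +
        ((2 * l).choose (l + (k + 1)) : ℝ) *
          Real.cos ((2 * ((l + (k + 1) : ℕ) : ℝ) - (2 * l : ℕ)) * (t - Real.pi / 2))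
      = 2 * (((2 * l).choose (l - (1 + k)) : ℝ) *
          ((-1) ^ (1 + k) * Real.cos (2 * ((1 + k : ℕ) : ℝ) * t))) := by
    intro k hk
    have hk : 1 + k ≤ l := by have := Finset.mem_range.mp hk; omega
    rw [Nat.sub_sub, ← cos_even_mul_sub,
      Nat.choose_symm_of_eq_add (show 2 * l = (l + (k + 1)) + (l - (1 + k)) by omega),
      ← Real.cos_neg ((2 * ((l - (1 + k) : ℕ) : ℝ) - _) * _)]
    push_cast [Nat.cast_sub hk]
    ring_nf
  rw [Finset.sum_congr rfl h2, ← Finset.mul_sum, mul_pow, pow_mul] at h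
  rw [← Finset.Ico_add_one_right_eq_Icc, Finset.sum_Ico_eq_sum_range, Nat.add_sub_cancel]
  norm_num at h
  rw [one_div, eq_inv_mul_iff_mul_eq₀ (by positivity)]
  push_cast
  linear_combination h

/-! ### Trigonometric moments and their recurrence -/

theorem hasDerivAt_pow_div_factorial (m : ℕ) (t : ℝ) :
    HasDerivAt (fun x : ℝ => x ^ (m + 1) / ((m + 1)! : ℝ)) (t ^ m / (m ! : ℝ)) t := by
  convert! (hasDerivAt_pow (m + 1) t).div_const ((m + 1)! : ℝ) using 1
  rw [Nat.factorial_succ]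
  have := Nat.factorial_ne_zero m
  push_cast
  field_simp

theorem integral_pow_succ_mul_sin (m : ℕ) {a : ℝ} (ha : a ≠ 0) (b : ℝ) :
    ∫ t in (0 : ℝ)..b, t ^ (m + 1) / ((m + 1)! : ℝ) * Real.sin (a * t) =
      -(b ^ (m + 1) / ((m + 1)! : ℝ) * (Real.cos (a * b) / a)) +
        (∫ t in (0 : ℝ)..b, t ^ m / (m ! : ℝ) * Real.cos (a * t)) / a := by
  have hv : ∀ t : ℝ, HasDerivAt (fun x => -(Real.cos (a * x) / a)) (Real.sin (a * t)) t := by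
    intro t
    have := ((((hasDerivAt_id t).const_mul a).cos).div_const a).neg
    convert! this using 1
    simp; field_simp
  rw [integral_mul_deriv_eq_deriv_mul (fun t _ => hasDerivAt_pow_div_factorial m t)
    (fun t _ => hv t) (Continuous.intervalIntegrable (by fun_prop) _ _)
    (Continuous.intervalIntegrable (by fun_prop) _ _), ← intervalIntegral.integral_div]
  simp only [mul_neg, intervalIntegral.integral_neg, mul_div_assoc]
  simp

theorem integral_pow_succ_mul_cos (m : ℕ) {a : ℝ} (ha : a ≠ 0) (b : ℝ) :
    ∫ t in (0 : ℝ)..b, t ^ (m + 1) / ((m + 1)! : ℝ) * Real.cos (a * t) =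
      b ^ (m + 1) / ((m + 1)! : ℝ) * (Real.sin (a * b) / a) -
        (∫ t in (0 : ℝ)..b, t ^ m / (m ! : ℝ) * Real.sin (a * t)) / a := by
  have hv : ∀ t : ℝ, HasDerivAt (fun x => Real.sin (a * x) / a) (Real.cos (a * t)) t := by
    intro t
    have := (((hasDerivAt_id t).const_mul a).sin).div_const a
    convert! this using 1
    simp; field_simp
  rw [integral_mul_deriv_eq_deriv_mul (fun t _ => hasDerivAt_pow_div_factorial m t)
    (fun t _ => hv t) (Continuous.intervalIntegrable (by fun_prop) _ _)
    (Continuous.intervalIntegrable (by fun_prop) _ _), ← intervalIntegral.integral_div]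
  simp only [mul_div_assoc]
  simp

theorem integral_sin_const_mul {a : ℝ} (ha : a ≠ 0) (b : ℝ) :
    ∫ t in (0 : ℝ)..b, Real.sin (a * t) = (1 - Real.cos (a * b)) / a := by
  rw [intervalIntegral.integral_comp_mul_left (fun x => Real.sin x) ha]
  simp [div_eq_inv_mul]

theorem integral_cos_const_mul {a : ℝ} (ha : a ≠ 0) (b : ℝ) :
    ∫ t in (0 : ℝ)..b, Real.cos (a * t) = Real.sin (a * b) / a := by
  rw [intervalIntegral.integral_comp_mul_left (fun x => Real.cos x) ha]
  simp [div_eq_inv_mul]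

theorem cos_odd_mul_pi_div_two (k : ℕ) : Real.cos ((2 * (k : ℝ) + 1) * (Real.pi / 2)) = 0 := by
  rw [show (2 * (k : ℝ) + 1) * (Real.pi / 2) = Real.pi / 2 + k * Real.pi by ring,
    Real.cos_add_nat_mul_pi]
  simp

theorem sin_odd_mul_pi_div_two (k : ℕ) :
    Real.sin ((2 * (k : ℝ) + 1) * (Real.pi / 2)) = (-1) ^ k := by
  rw [show (2 * (k : ℝ) + 1) * (Real.pi / 2) = Real.pi / 2 + k * Real.pi by ring,
    Real.sin_add_nat_mul_pi]
  simp

theorem cos_even_mul_pi_div_two (k : ℕ) :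
    Real.cos (2 * (k : ℝ) * (Real.pi / 2)) = (-1) ^ k := by
  rw [show 2 * (k : ℝ) * (Real.pi / 2) = k * Real.pi by ring, Real.cos_nat_mul_pi]

theorem sin_even_mul_pi_div_two (k : ℕ) : Real.sin (2 * (k : ℝ) * (Real.pi / 2)) = 0 := by
  rw [show 2 * (k : ℝ) * (Real.pi / 2) = k * Real.pi by ring, Real.sin_nat_mul_pi]

/-- Solution of the recurrence `S (p+1) = (y p - S p) / a²`. -/
theorem solve_recurrence {S y : ℕ → ℝ} {a : ℝ} (ha : a ≠ 0)
    (h : ∀ p, S (p + 1) = (y p - S p) / a ^ 2) (p : ℕ) :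
    S p = (-1) ^ p * (S 0 / a ^ (2 * p)) -
      (-1) ^ p * ∑ j ∈ Finset.range p, 1 / a ^ (2 * p - 2 * j) * ((-1) ^ j * y j) := by
  induction p with
  | zero => simp
  | succ p ih =>
    have hs : ∑ j ∈ Finset.range p, 1 / a ^ (2 * (p + 1) - 2 * j) * ((-1) ^ j * y j)
        = (∑ j ∈ Finset.range p, 1 / a ^ (2 * p - 2 * j) * ((-1) ^ j * y j)) / a ^ 2 := by
      rw [Finset.sum_div]
      refine Finset.sum_congr rfl fun j hj => ?_
      have hj := Finset.mem_range.mp hj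
      rw [show 2 * (p + 1) - 2 * j = (2 * p - 2 * j) + 2 by omega, pow_add]
      field_simp
    have hp : ((-1 : ℝ) ^ p) * (-1) ^ p = 1 := by rw [← mul_pow]; simp
    rw [h, ih, Finset.sum_range_succ, hs, show 2 * (p + 1) - 2 * p = 2 by omega,
      show 2 * (p + 1) = 2 * p + 2 by ring, pow_add a, pow_succ (-1 : ℝ) p]
    field_simp
    linear_combination (-y p * a ^ (2 * p)) * hp

/-- Of the boundary terms of two integrations by parts, those at 0 vanish with the power of t, and
at π/2 only the sine survives, with value (-1)^k. -/
theorem integral_pow_mul_sin_odd (m k : ℕ) :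
    ∫ t in (0 : ℝ)..(Real.pi / 2),
        t ^ (m + 2) / ((m + 2)! : ℝ) * Real.sin ((2 * (k : ℝ) + 1) * t) =
      ((-1) ^ k * ((Real.pi / 2) ^ (m + 1) / ((m + 1)! : ℝ)) - ∫ t in (0 : ℝ)..(Real.pi / 2),
        t ^ m / (m ! : ℝ) * Real.sin ((2 * (k : ℝ) + 1) * t)) / (2 * (k : ℝ) + 1) ^ 2 := by
  have ha : 2 * (k : ℝ) + 1 ≠ 0 := by positivity
  rw [integral_pow_succ_mul_sin _ ha, integral_pow_succ_mul_cos _ ha, cos_odd_mul_pi_div_two,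
    sin_odd_mul_pi_div_two]
  field_simp
  ring

theorem integral_pow_mul_cos_even (m : ℕ) {k : ℕ} (hk : k ≠ 0) :
    ∫ t in (0 : ℝ)..(Real.pi / 2),
        t ^ (m + 2) / ((m + 2)! : ℝ) * Real.cos (2 * (k : ℝ) * t) =
      ((-1) ^ k * ((Real.pi / 2) ^ (m + 1) / ((m + 1)! : ℝ)) - ∫ t in (0 : ℝ)..(Real.pi / 2),
        t ^ m / (m ! : ℝ) * Real.cos (2 * (k : ℝ) * t)) / (2 * (k : ℝ)) ^ 2 := by
  have ha : 2 * (k : ℝ) ≠ 0 := by positivity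
  rw [integral_pow_succ_mul_cos _ ha, integral_pow_succ_mul_sin _ ha, cos_even_mul_pi_div_two,
    sin_even_mul_pi_div_two]
  field_simp
  ring

theorem integral_pow_mul_sin_pow_odd (m l : ℕ) :
    ∫ t in (0 : ℝ)..(Real.pi / 2), t ^ m / (m ! : ℝ) * Real.sin t ^ (2 * l + 1) =
      1 / 4 ^ l * ∑ k ∈ Finset.range (l + 1), ((2 * l + 1).choose (l - k) : ℝ) * ((-1) ^ k *
        ∫ t in (0 : ℝ)..(Real.pi / 2), t ^ m / (m ! : ℝ) * Real.sin ((2 * (k : ℝ) + 1) * t)) := by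
  simp only [sin_pow_odd, ← intervalIntegral.integral_const_mul]
  rw [← intervalIntegral.integral_finsetSum
    fun k _ => Continuous.intervalIntegrable (by fun_prop) _ _,
    ← intervalIntegral.integral_const_mul]
  congr 1
  funext t
  simp only [Finset.mul_sum]
  refine Finset.sum_congr rfl fun k _ => ?_
  ring

theorem integral_pow_mul_sin_pow_even (m l : ℕ) :
    ∫ t in (0 : ℝ)..(Real.pi / 2), t ^ m / (m ! : ℝ) * Real.sin t ^ (2 * l) =
      1 / 4 ^ l * (((2 * l).choose l : ℝ) * ((Real.pi / 2) ^ (m + 1) / ((m + 1)! : ℝ)) +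
        2 * ∑ k ∈ Finset.Icc 1 l, ((2 * l).choose (l - k) : ℝ) * ((-1) ^ k *
        ∫ t in (0 : ℝ)..(Real.pi / 2), t ^ m / (m ! : ℝ) * Real.cos (2 * (k : ℝ) * t))) := by
  simp only [sin_pow_even, ← intervalIntegral.integral_const_mul, ← integral_pow_div_factorial]
  rw [← intervalIntegral.integral_finsetSum
    fun k _ => Continuous.intervalIntegrable (by fun_prop) _ _,
    ← intervalIntegral.integral_const_mul, ← intervalIntegral.integral_add
      (Continuous.intervalIntegrable (by fun_prop) _ _)
      (Continuous.intervalIntegrable (by fun_prop) _ _),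
    ← intervalIntegral.integral_const_mul]
  congr 1
  funext t
  simp only [mul_add, Finset.mul_sum]
  congr 1
  · ring
  · refine Finset.sum_congr rfl fun k _ => ?_
    ring

/-- The sign (-1)^k of the multiple-angle expansion cancels the one in the boundary terms, so only
the initial values `b k` keep an alternating sign. -/
theorem sum_mul_recurrence {s : Finset ℕ} {C a b z : ℕ → ℝ} {B : ℕ → ℕ → ℝ}
    (ha : ∀ k ∈ s, a k ≠ 0) (hb : ∀ k ∈ s, B k 0 = b k)
    (hB : ∀ k ∈ s, ∀ p, B k (p + 1) = ((-1) ^ k * z p - B k p) / a k ^ 2) (p : ℕ) :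
    ∑ k ∈ s, C k * ((-1) ^ k * B k p) =
      (-1) ^ p * ∑ k ∈ s, C k * (-1) ^ k * b k / a k ^ (2 * p) -
      (-1) ^ p * ∑ j ∈ Finset.range p,
        (∑ k ∈ s, C k / a k ^ (2 * p - 2 * j)) * ((-1) ^ j * z j) := by
  have hk : ∀ k ∈ s, C k * ((-1) ^ k * B k p) =
      (-1) ^ p * (C k * (-1) ^ k * b k / a k ^ (2 * p)) - (-1) ^ p * ∑ j ∈ Finset.range p,
        C k / a k ^ (2 * p - 2 * j) * ((-1) ^ j * z j) := by
    intro k hk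
    have h1 : ((-1 : ℝ) ^ k) * (-1) ^ k = 1 := by rw [← mul_pow]; simp
    have h2 : ∑ j ∈ Finset.range p, C k / a k ^ (2 * p - 2 * j) * ((-1) ^ j * z j) =
        C k * (-1) ^ k *
          ∑ j ∈ Finset.range p, 1 / a k ^ (2 * p - 2 * j) * ((-1) ^ j * ((-1) ^ k * z j)) := by
      rw [Finset.mul_sum]
      refine Finset.sum_congr rfl fun j _ => ?_
      linear_combination (-(C k / a k ^ (2 * p - 2 * j) * ((-1) ^ j * z j))) * h1
    rw [h2, solve_recurrence (ha k hk) (hB k hk) p, hb k hk]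
    ring
  rw [Finset.sum_congr rfl hk, Finset.sum_sub_distrib, ← Finset.mul_sum, ← Finset.mul_sum,
    Finset.sum_comm]
  simp only [Finset.sum_mul]

theorem integral_even_pow_mul_sin_pow_odd (p l : ℕ) :
    ∫ t in (0 : ℝ)..(Real.pi / 2), t ^ (2 * p) / ((2 * p)! : ℝ) * Real.sin t ^ (2 * l + 1) =
      1 / 4 ^ l * ((-1) ^ p * ∑ k ∈ Finset.range (l + 1),
        ((2 * l + 1).choose (l - k) : ℝ) * (-1) ^ k * (1 / (2 * (k : ℝ) + 1)) /
          (2 * (k : ℝ) + 1) ^ (2 * p) -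
      (-1) ^ p * ∑ j ∈ Finset.range p, (∑ k ∈ Finset.range (l + 1),
        ((2 * l + 1).choose (l - k) : ℝ) / (2 * (k : ℝ) + 1) ^ (2 * p - 2 * j)) *
          ((-1) ^ j * ((Real.pi / 2) ^ (2 * j + 1) / ((2 * j + 1)! : ℝ)))) := by
  rw [integral_pow_mul_sin_pow_odd, ← sum_mul_recurrence
    (B := fun k p => ∫ t in (0 : ℝ)..(Real.pi / 2),
      t ^ (2 * p) / ((2 * p)! : ℝ) * Real.sin ((2 * (k : ℝ) + 1) * t))
    (fun k _ => by positivity) (fun k _ => ?_)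
    (fun k _ p => integral_pow_mul_sin_odd (2 * p) k)]
  have ha : 2 * (k : ℝ) + 1 ≠ 0 := by positivity
  simp [integral_sin_const_mul ha, cos_odd_mul_pi_div_two]

theorem integral_odd_pow_mul_sin_pow_odd (p l : ℕ) :
    ∫ t in (0 : ℝ)..(Real.pi / 2),
        t ^ (2 * p + 1) / ((2 * p + 1)! : ℝ) * Real.sin t ^ (2 * l + 1) =
      1 / 4 ^ l * ((-1) ^ p * ∑ j ∈ Finset.range (p + 1), (∑ k ∈ Finset.range (l + 1),
        ((2 * l + 1).choose (l - k) : ℝ) / (2 * (k : ℝ) + 1) ^ (2 * (p + 1) - 2 * j)) *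
          ((-1) ^ j * ((Real.pi / 2) ^ (2 * j) / ((2 * j)! : ℝ)))) := by
  have h := sum_mul_recurrence (s := Finset.range (l + 1)) (b := 0)
    (a := fun k => 2 * (k : ℝ) + 1) (C := fun k => ((2 * l + 1).choose (l - k) : ℝ))
    (z := fun j => (Real.pi / 2) ^ (2 * j) / ((2 * j)! : ℝ))
    -- Odd moments start at index 1. The artificial value 0 at index 0 makes the recurrence give the
    -- correct first moment ∫ t sin(at) = (-1)^k/a².
    (B := fun k p => p.casesOn 0 fun q => ∫ t in (0 : ℝ)..(Real.pi / 2),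
      t ^ (2 * q + 1) / ((2 * q + 1)! : ℝ) * Real.sin ((2 * (k : ℝ) + 1) * t))
    (fun k _ => by positivity) (fun k _ => rfl) (fun k _ q => by
      have ha : 2 * (k : ℝ) + 1 ≠ 0 := by positivity
      cases q with
      | zero =>
        have := integral_pow_succ_mul_sin 0 ha (Real.pi / 2)
        simp only [pow_zero, Nat.factorial_zero, Nat.cast_one, div_one, one_mul] at this
        rw [integral_cos_const_mul ha, cos_odd_mul_pi_div_two, sin_odd_mul_pi_div_two] at this
        simp only [mul_zero, zero_add, pow_zero, Nat.factorial_zero, Nat.cast_one, div_one,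
          mul_one] at this ⊢
        rw [this]
        field_simp
        simp
      | succ q => exact integral_pow_mul_sin_odd (2 * q + 1) k) (p + 1)
  rw [integral_pow_mul_sin_pow_odd, h]
  simp [pow_succ]

/-- The powers of 2 from 2k and from π/2 have total exponent (2p-2j) + (2j+i), independent of j. -/
theorem sum_rescale {s : Finset ℕ} (C : ℕ → ℝ) (r : ℕ → ℝ) (p i : ℕ) :
    ∑ j ∈ Finset.range p, (∑ k ∈ s, C k / (2 * (k : ℝ)) ^ (2 * p - 2 * j)) *
        ((-1) ^ j * ((Real.pi / 2) ^ (2 * j + i) / r j)) =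
      1 / 2 ^ (2 * p + i) * ∑ j ∈ Finset.range p, (∑ k ∈ s, C k / (k : ℝ) ^ (2 * p - 2 * j)) *
        ((-1) ^ j * Real.pi ^ (2 * j + i) / r j) := by
  rw [Finset.mul_sum]
  refine Finset.sum_congr rfl fun j hj => ?_
  have hj := Finset.mem_range.mp hj
  have h2 : (2 : ℝ) ^ (2 * p + i) = 2 ^ (2 * p - 2 * j) * 2 ^ (2 * j + i) := by
    rw [← pow_add]; congr 1; omega
  have h3 : ∑ k ∈ s, C k / (2 * (k : ℝ)) ^ (2 * p - 2 * j) =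
      1 / 2 ^ (2 * p - 2 * j) * ∑ k ∈ s, C k / (k : ℝ) ^ (2 * p - 2 * j) := by
    rw [Finset.mul_sum]
    refine Finset.sum_congr rfl fun k _ => ?_
    rw [mul_pow, div_mul_div_comm, one_mul]
  rw [h3, h2, div_pow]
  field_simp

theorem integral_even_pow_mul_sin_pow_even (p l : ℕ) :
    ∫ t in (0 : ℝ)..(Real.pi / 2), t ^ (2 * p) / ((2 * p)! : ℝ) * Real.sin t ^ (2 * l) =
      1 / 4 ^ l * (((2 * l).choose l : ℝ) *
          ((Real.pi / 2) ^ (2 * p + 1) / ((2 * p + 1)! : ℝ)) -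
        2 * ((-1) ^ p * ∑ j ∈ Finset.range p, (∑ k ∈ Finset.Icc 1 l,
          ((2 * l).choose (l - k) : ℝ) / (2 * (k : ℝ)) ^ (2 * p - 2 * j)) *
            ((-1) ^ j * ((Real.pi / 2) ^ (2 * j + 1) / ((2 * j + 1)! : ℝ))))) := by
  have hk0 : ∀ k ∈ Finset.Icc 1 l, k ≠ 0 := fun k hk => by
    have := Finset.mem_Icc.mp hk; omega
  have ha : ∀ k ∈ Finset.Icc 1 l, 2 * (k : ℝ) ≠ 0 := fun k hk => by simp [hk0 k hk]
  -- The initial values are ∫ cos(2kt) = 0, so no alternating sum remains.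
  have h := sum_mul_recurrence (s := Finset.Icc 1 l) (b := 0)
    (C := fun k => ((2 * l).choose (l - k) : ℝ))
    (B := fun k p => ∫ t in (0 : ℝ)..(Real.pi / 2),
      t ^ (2 * p) / ((2 * p)! : ℝ) * Real.cos (2 * (k : ℝ) * t))
    ha (fun k hk => by
      simp only [mul_zero, pow_zero, Nat.factorial_zero, Nat.cast_one, div_one, one_mul]
      rw [integral_cos_const_mul (ha k hk), sin_even_mul_pi_div_two]
      simp)
    (fun k hk p => integral_pow_mul_cos_even (2 * p) (hk0 k hk)) p
  rw [integral_pow_mul_sin_pow_even, h]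
  simp
  ring

theorem integral_odd_pow_mul_sin_pow_even (p l : ℕ) :
    ∫ t in (0 : ℝ)..(Real.pi / 2), t ^ (2 * p + 1) / ((2 * p + 1)! : ℝ) * Real.sin t ^ (2 * l) =
      1 / 4 ^ l * (((2 * l).choose l : ℝ) *
          ((Real.pi / 2) ^ (2 * p + 1 + 1) / ((2 * p + 1 + 1)! : ℝ)) +
        2 * ((-1) ^ (p + 1) * ∑ k ∈ Finset.Icc 1 l,
            ((2 * l).choose (l - k) : ℝ) * (-1) ^ k * 1 / (2 * (k : ℝ)) ^ (2 * (p + 1)) -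
          (-1) ^ (p + 1) * ∑ j ∈ Finset.range (p + 1), (∑ k ∈ Finset.Icc 1 l,
          ((2 * l).choose (l - k) : ℝ) / (2 * (k : ℝ)) ^ (2 * (p + 1) - 2 * j)) *
            ((-1) ^ j * ((Real.pi / 2) ^ (2 * j) / ((2 * j)! : ℝ))))) := by
  have hk0 : ∀ k ∈ Finset.Icc 1 l, k ≠ 0 := fun k hk => by
    have := Finset.mem_Icc.mp hk; omega
  have ha : ∀ k ∈ Finset.Icc 1 l, 2 * (k : ℝ) ≠ 0 := fun k hk => by simp [hk0 k hk]
  have h := sum_mul_recurrence (s := Finset.Icc 1 l) (b := 1)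
    (C := fun k => ((2 * l).choose (l - k) : ℝ))
    (z := fun j => (Real.pi / 2) ^ (2 * j) / ((2 * j)! : ℝ))
    -- Here the artificial value is 1, because ∫ t cos(at) = ((-1)^k - 1)/a²; it is the source of
    -- the alternating sum in the last formula.
    (B := fun k p => p.casesOn 1 fun q => ∫ t in (0 : ℝ)..(Real.pi / 2),
      t ^ (2 * q + 1) / ((2 * q + 1)! : ℝ) * Real.cos (2 * (k : ℝ) * t))
    ha (fun k _ => rfl) (fun k hk q => by
      cases q with
      | zero =>
        have := integral_pow_succ_mul_cos 0 (ha k hk) (Real.pi / 2)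
        simp only [pow_zero, Nat.factorial_zero, Nat.cast_one, div_one, one_mul] at this
        rw [integral_sin_const_mul (ha k hk), cos_even_mul_pi_div_two,
          sin_even_mul_pi_div_two] at this
        simp only [mul_zero, zero_add, pow_zero, Nat.factorial_zero, Nat.cast_one, div_one,
          mul_one] at this ⊢
        change _ = ((-1 : ℝ) ^ k - 1) / (2 * (k : ℝ)) ^ 2
        rw [this]
        have := ha k hk
        field_simp
        ring
      | succ q => exact integral_pow_mul_cos_even (2 * q + 1) (hk0 k hk)) (p + 1)
  rw [integral_pow_mul_sin_pow_even]
  exact congrArg (fun x => 1 / 4 ^ l * (((2 * l).choose l : ℝ) *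
    ((Real.pi / 2) ^ (2 * p + 1 + 1) / ((2 * p + 1 + 1)! : ℝ)) + 2 * x)) h

end

/-! ### The four evaluations -/

theorem corollary2p3 (ℓ p : ℕ) :
    HasSum (fun k : ℕ =>
        ((2 * k).choose k : ℝ) * arcsinG p k / (4 ^ k * (2 * (k : ℝ) + 2 * (ℓ : ℝ) + 2)))
      ((-1 : ℝ) ^ ((p : ℤ) - 1) / 4 ^ ℓ *
          ∑ j ∈ Finset.range p,
            (∑ k ∈ Finset.range (ℓ + 1),
              ((2 * ℓ + 1).choose (ℓ - k) : ℝ) / (2 * (k : ℝ) + 1) ^ (2 * p - 2 * j)) *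
            ((-1 : ℝ) ^ j * (Real.pi / 2) ^ (2 * j + 1) / ((2 * j + 1)! : ℝ))
        + (-1 : ℝ) ^ p / 4 ^ ℓ *
          ∑ k ∈ Finset.range (ℓ + 1),
            ((2 * ℓ + 1).choose (ℓ - k) : ℝ) * (-1) ^ k / (2 * (k : ℝ) + 1) ^ (2 * p + 1))
    ∧ HasSum (fun k : ℕ =>
        ((2 * k).choose k : ℝ) * arcsinG p k / (4 ^ k * (2 * (k : ℝ) + 2 * (ℓ : ℝ) + 1)))
      ((-1 : ℝ) ^ ((p : ℤ) - 1) / 4 ^ (ℓ + p) *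
          ∑ j ∈ Finset.range p,
            (∑ k ∈ Finset.Icc 1 ℓ,
              ((2 * ℓ).choose (ℓ - k) : ℝ) / (k : ℝ) ^ (2 * p - 2 * j)) *
            ((-1 : ℝ) ^ j * Real.pi ^ (2 * j + 1) / ((2 * j + 1)! : ℝ))
        + ((2 * ℓ).choose ℓ : ℝ) / 2 ^ (2 * ℓ + 2 * p + 1) *
            (Real.pi ^ (2 * p + 1) / ((2 * p + 1)! : ℝ)))
    ∧ (1 ≤ p →
      -- the summation index below is `k + 1`, so that it runs over the positive integers
      HasSum (fun k : ℕ =>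
          (4 : ℝ) ^ (k + 1) * arcsinH p (k + 1) /
            (((2 * (k + 1)).choose (k + 1) : ℝ) * (2 * ((k : ℝ) + 1)) *
              (2 * ((k : ℝ) + 1) + 2 * (ℓ : ℝ) + 1)))
        ((-1 : ℝ) ^ (p - 1) / 4 ^ ℓ *
          ∑ j ∈ Finset.range p,
            (∑ k ∈ Finset.range (ℓ + 1),
              ((2 * ℓ + 1).choose (ℓ - k) : ℝ) / (2 * (k : ℝ) + 1) ^ (2 * p - 2 * j)) *
            ((-1 : ℝ) ^ j * (Real.pi / 2) ^ (2 * j) / ((2 * j)! : ℝ)))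
      ∧ HasSum (fun k : ℕ =>
          (4 : ℝ) ^ (k + 1) * arcsinH p (k + 1) /
            (((2 * (k + 1)).choose (k + 1) : ℝ) * (2 * ((k : ℝ) + 1)) *
              (2 * ((k : ℝ) + 1) + 2 * (ℓ : ℝ))))
        ((-1 : ℝ) ^ (p - 1) / 2 ^ (2 * ℓ + 2 * p - 1) *
            ∑ j ∈ Finset.range p,
              (∑ k ∈ Finset.Icc 1 ℓ,
                ((2 * ℓ).choose (ℓ - k) : ℝ) / (k : ℝ) ^ (2 * p - 2 * j)) *
              ((-1 : ℝ) ^ j * Real.pi ^ (2 * j) / ((2 * j)! : ℝ))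
          + ((2 * ℓ).choose ℓ : ℝ) / 4 ^ (ℓ + p) * (Real.pi ^ (2 * p) / ((2 * p)! : ℝ))
          + (-1 : ℝ) ^ p / 2 ^ (2 * ℓ + 2 * p - 1) *
            ∑ k ∈ Finset.Icc 1 ℓ,
              ((2 * ℓ).choose (ℓ - k) : ℝ) * (-1) ^ k / (k : ℝ) ^ (2 * p))) := by
  -- The integer exponent covers p = 0, where p - 1 is negative.
  have hz : (-1 : ℝ) ^ ((p : ℤ) - 1) = -(-1) ^ p := by
    rw [zpow_sub_one₀ (by norm_num), zpow_natCast]; norm_num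
  have h42 : (4 : ℝ) = 2 ^ 2 := by norm_num
  refine ⟨?_, ?_, fun hp => ?_⟩
  · convert! hasSum_nestedSum_integral (e := 0) (by norm_num) p (2 * ℓ + 1) using 1
    · funext k
      rw [add_zero, wallisRatio_two_mul, arcsinG_eq_nestedSum]
      push_cast
      field_simp
      ring
    · have h1 : ∀ k : ℕ, ((2 * ℓ + 1).choose (ℓ - k) : ℝ) * (-1) ^ k *
          (1 / (2 * (k : ℝ) + 1)) / (2 * (k : ℝ) + 1) ^ (2 * p) =
          ((2 * ℓ + 1).choose (ℓ - k) : ℝ) * (-1) ^ k / (2 * (k : ℝ) + 1) ^ (2 * p + 1) := by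
        intro k
        rw [pow_succ]
        field_simp
      rw [add_zero, integral_even_pow_mul_sin_pow_odd, hz]
      simp only [h1]
      simp only [mul_div_assoc]
      ring
  · convert! hasSum_nestedSum_integral (e := 0) (by norm_num) p (2 * ℓ) using 1
    · funext k
      rw [add_zero, wallisRatio_two_mul, arcsinG_eq_nestedSum]
      push_cast
      field_simp
      ring
    · rw [add_zero, integral_even_pow_mul_sin_pow_even, sum_rescale, hz, h42]
      simp only [← pow_mul, div_pow]
      field_simp
      ring
  -- `arcsinH (q + 1)` is a q-fold sum, so it is paired with the moment of order 2q+1.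
  obtain ⟨q, rfl⟩ : ∃ q, p = q + 1 := ⟨p - 1, by omega⟩
  constructor
  · convert! hasSum_nestedSum_integral (e := 1) (by norm_num) q (2 * ℓ + 1) using 1
    · funext k
      rw [wallisRatio_two_mul_add_one, arcsinH, Nat.add_sub_cancel, arcsinHSucc_succ_eq_nestedSum]
      push_cast
      field_simp
      ring
    · rw [integral_odd_pow_mul_sin_pow_odd, Nat.add_sub_cancel]
      simp only [mul_div_assoc]
      ring
  · convert! hasSum_nestedSum_integral (e := 1) (by norm_num) q (2 * ℓ) using 1
    · funext k
      rw [wallisRatio_two_mul_add_one, arcsinH, Nat.add_sub_cancel, arcsinHSucc_succ_eq_nestedSum]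
      push_cast
      field_simp
      ring
    · have h := sum_rescale (s := Finset.Icc 1 ℓ) (fun k => ((2 * ℓ).choose (ℓ - k) : ℝ))
        (fun j => ((2 * j)! : ℝ)) (q + 1) 0
      simp only [add_zero] at h
      have h' : ∑ k ∈ Finset.Icc 1 ℓ,
            ((2 * ℓ).choose (ℓ - k) : ℝ) * (-1) ^ k * 1 / (2 * (k : ℝ)) ^ (2 * (q + 1)) =
          1 / 2 ^ (2 * (q + 1)) * ∑ k ∈ Finset.Icc 1 ℓ,
            ((2 * ℓ).choose (ℓ - k) : ℝ) * (-1) ^ k / (k : ℝ) ^ (2 * (q + 1)) := by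
        rw [Finset.mul_sum]
        refine Finset.sum_congr rfl fun k _ => ?_
        rw [mul_pow, div_mul_div_comm, one_mul, mul_one]
      rw [integral_odd_pow_mul_sin_pow_even, h, h', h42, Nat.add_sub_cancel,
        show 2 * ℓ + 2 * (q + 1) - 1 = 2 * ℓ + 2 * q + 1 by omega,
        show 2 * q + 1 + 1 = 2 * (q + 1) by ring]
      simp only [← pow_mul, div_pow]
      generalize (∑ j ∈ Finset.range (q + 1), _ : ℝ) = X
      generalize (∑ k ∈ Finset.Icc 1 ℓ, _ : ℝ) = Y
      field_simp
      ring
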